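/- Let $\Omega=[-1,1]$, and for $y\in[0,1]$ let $u_y$ be the probability measure on $\Omega$ with density $\mathbb 1_{[y-1,y]}$ with respect to Lebesgue measure, identified with its density when it is regarded as an element of the real Hilbert space $L^2(\Omega)$. Let $\mathcal M=\{u_y : y\in[0,1]\}$. For a family $v=(v_y)_{y\in[0,1]}$ in a real normed space $V$, with set of values $\mathcal F=\{v_y : y\in[0,1]\}$, and $n\in\mathbb N$, define the Kolmogorov widths $$d_n(\mathcal F,V)=\inf_{\dim W=n}\ \sup_{y\in[0,1]}\ \inf_{w\in W}\|v_y-w\|_V,\qquad \delta_n(\mathcal F,V)=\inf_{\dim W=n}\Big(\int_0^1 \inf_{w\in W}\|v_y-w\|_V^2\,dy\Big)^{1/2},$$ where the infima are over linear subspaces $W\subset V$ of dimension $n$ (so the parameter $y$ is uniformly distributed on $[0,1]$ in $\delta_n$). For a probability measure $u$ on $\Omega$ let $\operatorname{cdf}_u(x)=u([-1,x])$ for $x \in \Omega$, and $\operatorname{icdf}_u(s)=\inf\{x\in\Omega : \operatorname{cdf}_u(x)>s\}$ for $s\in[0,1]$ (with $\inf\emptyset=1$). Fix $y_0\in[0,1]$,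 put $w=u_{y_0}$, and let $$\mathcal T=\{\operatorname{icdf}_{u_y}-\operatorname{icdf}_w : y\in[0,1]\}\subset L^2([0,1]).$$ Then: 1. There is a constant $c>0$ such that for all integers $n\ge 1$, $$d_n(\mathcal M,L^2(\Omega))\ \ge\ \delta_n(\mathcal M,L^2(\Omega))\ \ge\ c\,n^{-1/2}.$$ 2. For every $y_0\in[0,1]$, the set $\mathcal T$ is contained in the one-dimensional subspace of (almost everywhere) constant functions in $L^2([0,1])$, and $d_n(\mathcal T,L^2([0,1]))=0$ for all integers $n>1$. (Context, not part of the claim: $\mathbb 1_{[y-1,y]}$ is the state at time $1$ of the solution of $\partial_t\rho+y\,\partial_x\rho=0$ with $\rho(0,\cdot)=\mathbb 1_{]-1,0]}$, up to a null set.) -/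

import Mathlib

open MeasureTheory
open scoped ENNReal

namespace TransportWidth

noncomputable section

/-! ## Kolmogorov widths of a parametrized family `u : Z → V`

All errors and widths take values in `[0, ∞]`. -/

/-- Worst-case error `sup_{z ∈ Z} inf_{w ∈ W} d(u z, w)`. -/
def worstError {Z V : Type*} [NormedAddCommGroup V] [NormedSpace ℝ V]
    (u : Z → V) (W : Submodule ℝ V) : ℝ≥0∞ :=
  ⨆ z : Z, Metric.infEDist (u z) (W : Set V)

/-- Average error `(∫_Z inf_{w ∈ W} d(u z, w)² dμ(z))^{1/2}`. -/
def averageError {Z V : Type*} [MeasurableSpace Z] [NormedAddCommGroup V] [NormedSpace ℝ V]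
    (μ : Measure Z) (u : Z → V) (W : Submodule ℝ V) : ℝ≥0∞ :=
  (∫⁻ z, Metric.infEDist (u z) (W : Set V) ^ 2 ∂μ) ^ (1 / 2 : ℝ)

/-- The `L^∞` Kolmogorov width `d_n` of the set `{u z : z ∈ Z}` in `V`: infimum of the worst-case
error over all linear subspaces of dimension `n`. -/
def kolmogorovWidth {Z V : Type*} [NormedAddCommGroup V] [NormedSpace ℝ V]
    (u : Z → V) (n : ℕ) : ℝ≥0∞ :=
  ⨅ (W : Submodule ℝ V) (_ : FiniteDimensional ℝ W ∧ Module.finrank ℝ W = n), worstError u W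

/-- The `L^2` Kolmogorov width `δ_n` of the set `{u z : z ∈ Z}` in `V`, the parameter `z` being
distributed according to `μ`: infimum of the average error over all linear subspaces of
dimension `n`. -/
def averageKolmogorovWidth {Z V : Type*} [MeasurableSpace Z] [NormedAddCommGroup V]
    [NormedSpace ℝ V] (μ : Measure Z) (u : Z → V) (n : ℕ) : ℝ≥0∞ :=
  ⨅ (W : Submodule ℝ V) (_ : FiniteDimensional ℝ W ∧ Module.finrank ℝ W = n),
    averageError μ u W

/-! ## Probability measures on `Ω = [-1, 1]` and the logarithmic map

As `Ω` is compact, every probability measure on it has a finite second moment. -/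

instance factNegOneLeOne : Fact ((-1 : ℝ) ≤ 1) := ⟨by norm_num⟩

/-- The spatial domain `Ω = [-1, 1]`. -/
abbrev Omega : Type := Set.Icc (-1 : ℝ) 1

/-- The parameter domain, and the domain of inverse distribution functions, `[0, 1]`. -/
abbrev Unit01 : Type := Set.Icc (0 : ℝ) 1

/-- Lebesgue measure on `Ω`. -/
instance measureSpaceOmega : MeasureSpace Omega := Measure.Subtype.measureSpace

instance isFiniteMeasureOmega : IsFiniteMeasure (volume : Measure Omega) := by
  refine ⟨?_⟩
  rw [Measure.Subtype.volume_univ measurableSet_Icc.nullMeasurableSet, Real.volume_Icc]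
  exact ENNReal.ofReal_lt_top

/-- `L²(Ω)` with Lebesgue measure. -/
abbrev L2Omega : Type := Lp ℝ 2 (volume : Measure Omega)

/-- `L²([0, 1])` with Lebesgue measure. -/
abbrev L2Unit : Type := Lp ℝ 2 (volume : Measure Unit01)

/-- Cumulative distribution function `x ↦ u([-1, x])`. -/
def cdf (u : ProbabilityMeasure Omega) (x : Omega) : ℝ :=
  (u : Measure Omega).real (Set.Iic x)

/-- Generalized inverse `s ↦ inf {x ∈ Ω : cdf_u(x) > s}`. The infimum is taken in the complete
lattice `Ω = [-1, 1]`, so that it is `1` when the set is empty (which happens only for `s = 1`). -/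
def icdf (u : ProbabilityMeasure Omega) (s : Unit01) : Omega :=
  sInf {x : Omega | (s : ℝ) < cdf u x}

theorem icdf_monotone (u : ProbabilityMeasure Omega) : Monotone (icdf u) := fun _ _ hst =>
  sInf_le_sInf fun _ hx => lt_of_le_of_lt (Subtype.coe_le_coe.mpr hst) hx

theorem icdf_memLp (u : ProbabilityMeasure Omega) :
    MemLp (fun s : Unit01 => (icdf u s : ℝ)) 2 volume := by
  have hm : Monotone (fun s : Unit01 => (icdf u s : ℝ)) := fun _ _ h => icdf_monotone u h
  refine MemLp.of_bound hm.measurable.aestronglyMeasurable 1 (Filter.Eventually.of_forall ?_)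
  intro s
  rw [Real.norm_eq_abs, abs_le]
  exact (icdf u s).2

/-- `icdf_u` as an element of `L²([0, 1])`. -/
def icdfL2 (u : ProbabilityMeasure Omega) : L2Unit := (icdf_memLp u).toLp _

/-- The logarithmic map `Log_w(u) = icdf_u - icdf_w ∈ L²([0, 1])`. -/
def logMap (w u : ProbabilityMeasure Omega) : L2Unit := icdfL2 u - icdfL2 w

/-! ## The family `u(y) = 𝟙_{[y-1, y]} dx`, `y ∈ [0, 1]` -/

/-- The density `𝟙_{[y-1, y]}` on `Ω`. -/
def density (y : Unit01) (x : Omega) : ℝ :=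
  (Set.Icc ((y : ℝ) - 1) (y : ℝ)).indicator (fun _ => 1) (x : ℝ)

theorem density_measurable (y : Unit01) : Measurable (density y) :=
  (measurable_const.indicator measurableSet_Icc).comp measurable_subtype_coe

theorem density_memLp (y : Unit01) : MemLp (density y) 2 (volume : Measure Omega) := by
  refine MemLp.of_bound (density_measurable y).aestronglyMeasurable 1
    (Filter.Eventually.of_forall fun x => ?_)
  unfold density
  exact (norm_indicator_le_norm_self (fun _ : ℝ => (1 : ℝ)) (x : ℝ)).trans (by simp)

/-- The density `𝟙_{[y-1, y]}` as an element of `L²(Ω)`. -/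
def solL2 (y : Unit01) : L2Omega := (density_memLp y).toLp _

/-- The measure `𝟙_{[y-1, y]} dx` on `Ω`. -/
def solMeasure (y : Unit01) : Measure Omega :=
  (volume : Measure Omega).withDensity fun x => ENNReal.ofReal (density y x)

theorem solMeasure_univ (y : Unit01) : solMeasure y Set.univ = 1 := by
  have hy := y.2
  have h1 : (fun x : Omega => ENNReal.ofReal (density y x)) =
      ((↑) ⁻¹' Set.Icc ((y : ℝ) - 1) (y : ℝ) : Set Omega).indicator 1 := by
    funext x
    by_cases hx : (x : ℝ) ∈ Set.Icc ((y : ℝ) - 1) (y : ℝ)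
    · rw [Set.indicator_of_mem (by exact hx)]
      simp [density, Set.indicator_of_mem hx]
    · rw [Set.indicator_of_notMem (by exact hx)]
      simp [density, Set.indicator_of_notMem hx]
  have hms : MeasurableSet ((↑) ⁻¹' Set.Icc ((y : ℝ) - 1) (y : ℝ) : Set Omega) :=
    measurable_subtype_coe measurableSet_Icc
  rw [solMeasure, withDensity_apply _ MeasurableSet.univ, Measure.restrict_univ, h1,
    lintegral_indicator_one hms, Measure.Subtype.volume_def,
    comap_subtype_coe_apply measurableSet_Icc, Subtype.image_preimage_coe,
    Set.inter_eq_right.mpr, Real.volume_Icc]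
  · simp
  · exact Set.Icc_subset_Icc (by linarith [hy.1]) hy.2

/-- `u(y) = 𝟙_{[y-1, y]} dx` as a probability measure on `Ω`. -/
def sol (y : Unit01) : ProbabilityMeasure Omega :=
  ⟨solMeasure y, ⟨solMeasure_univ y⟩⟩

end

end TransportWidth

open TransportWidth

/-! The curve `y ↦ solL2 y` behaves like a Brownian path: inner products are `1 - |y - z|`, so
squared increments have size `2 |y - z|` and increments over non-overlapping intervals are
orthogonal (`inner_solL2_increments_eq_zero`). On a grid of `N = 2n + 2` points with spacing `1 /
N`, the `2n + 1` increments are orthogonal with squared norm `2 / N`. An `n`-dimensional `W` absorbs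
at most `n` of them in the trace sense (`mul_card_sub_finrank_le_sum_infDist_sq`), so their squared
distances to `W` sum to at least `1`, and those of the grid points to at least `1 / 4`. Averaging
over translates of the grid bounds the integral below by `1 / (4N) ≥ 1 / (16n)`, hence `c = 1 / 4`.

For the second claim, the inverse distribution function of `sol y` is `y - 1 + s` for `s < 1`, so a
change of `y` only adds a constant, and any `W` containing the constants has error zero. -/

namespace TransportWidth

/-! ### Orthogonal systems and distances to a subspace -/

section Hilbert
variable {E : Type*} [NormedAddCommGroup E] [InnerProductSpace ℝ E]

theorem infDist_submodule_eq_norm_sub_starProjection (W : Submodule ℝ E)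
    [W.HasOrthogonalProjection] (x : E) :
    Metric.infDist x (W : Set E) = ‖x - W.starProjection x‖ := by
  rw [Submodule.starProjection_minimal, Metric.infDist_eq_iInf]
  simp only [dist_eq_norm]
  rfl

theorem infDist_submodule_sub_sq_le (W : Submodule ℝ E)
    [W.HasOrthogonalProjection] (x y : E) :
    Metric.infDist (x - y) (W : Set E) ^ 2 ≤
      2 * (Metric.infDist x (W : Set E) ^ 2 + Metric.infDist y (W : Set E) ^ 2) := by
  simp only [infDist_submodule_eq_norm_sub_starProjection, map_sub]
  have h := norm_sub_le (x - W.starProjection x) (y - W.starProjection y)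
  rw [sub_sub_sub_comm]
  nlinarith [sq_nonneg (‖x - W.starProjection x‖ - ‖y - W.starProjection y‖),
    norm_nonneg (x - W.starProjection x - (y - W.starProjection y))]

/-- By Pythagoras the claim is that the squared projections sum to at most the dimension. Expanding
in an orthonormal basis of `W` and exchanging sums, Bessel's inequality for `e` bounds the
contribution of each basis vector by `1`. -/
theorem orthonormal_card_le_finrank_add_sum_infDist_sq {ι : Type*} [Fintype ι] {e : ι → E}
    (he : Orthonormal ℝ e) (W : Submodule ℝ E) [FiniteDimensional ℝ W] :
    (Fintype.card ι : ℝ) ≤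
      Module.finrank ℝ W + ∑ i, Metric.infDist (e i) (W : Set E) ^ 2 := by
  let b := stdOrthonormalBasis ℝ W
  have hP : ∀ i, ‖W.orthogonalProjectionOnto (e i)‖ ^ 2 = ∑ j, ‖inner ℝ (e i) (b j : E)‖ ^ 2 := by
    intro i
    rw [← b.sum_sq_norm_inner_left]
    refine Finset.sum_congr rfl fun j _ => ?_
    rw [Submodule.inner_orthogonalProjectionOnto_eq_of_mem_right]
  have hsum : ∑ i, ‖W.orthogonalProjectionOnto (e i)‖ ^ 2 ≤ Module.finrank ℝ W := by
    simp only [hP]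
    rw [Finset.sum_comm]
    calc _ ≤ ∑ j, ‖(b j : E)‖ ^ 2 := Finset.sum_le_sum fun j _ => he.sum_inner_products_le _
      _ = _ := by
        have : ∀ j, ‖(b j : E)‖ = 1 := fun j => b.orthonormal.1 j
        simp [this]
  have hpy : ∀ i, Metric.infDist (e i) (W : Set E) ^ 2 =
      1 - ‖W.orthogonalProjectionOnto (e i)‖ ^ 2 := by
    intro i
    rw [infDist_submodule_eq_norm_sub_starProjection]
    have h := W.norm_sq_eq_add_norm_sq_starProjection (e i)
    rw [he.1 i, Submodule.starProjection_orthogonal_val] at h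
    have h' : ‖W.starProjection (e i)‖ = ‖W.orthogonalProjectionOnto (e i)‖ := rfl
    rw [h'] at h
    linarith
  simp only [hpy, Finset.sum_sub_distrib, Finset.sum_const, Finset.card_univ, nsmul_eq_mul, mul_one]
  linarith

theorem mul_card_sub_finrank_le_sum_infDist_sq {ι : Type*} [Fintype ι] {e : ι → E} {r : ℝ}
    (hr : 0 < r) (hnorm : ∀ i, ‖e i‖ ^ 2 = r) (horth : Pairwise fun i j => inner ℝ (e i) (e j) = 0)
    (W : Submodule ℝ E) [FiniteDimensional ℝ W] :
    r * (Fintype.card ι - Module.finrank ℝ W) ≤ ∑ i, Metric.infDist (e i) (W : Set E) ^ 2 := by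
  set s := Real.sqrt r
  have hs : 0 < s := Real.sqrt_pos.2 hr
  have hsr : s ^ 2 = r := Real.sq_sqrt hr.le
  have hn : ∀ i, ‖e i‖ = s := fun i => by
    rw [← Real.sqrt_sq (norm_nonneg (e i)), hnorm]
  have he : Orthonormal ℝ fun i => s⁻¹ • e i := by
    refine ⟨fun i => ?_, fun i j hij => ?_⟩
    · rw [norm_smul, hn, Real.norm_of_nonneg (inv_nonneg.2 hs.le), inv_mul_cancel₀ hs.ne']
    · simp [inner_smul_left, inner_smul_right, horth hij]
  have h := orthonormal_card_le_finrank_add_sum_infDist_sq he W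
  have hd : ∀ i, Metric.infDist (s⁻¹ • e i) (W : Set E) ^ 2 =
      r⁻¹ * Metric.infDist (e i) (W : Set E) ^ 2 := by
    intro i
    rw [infDist_submodule_eq_norm_sub_starProjection, infDist_submodule_eq_norm_sub_starProjection,
      map_smul, ← smul_sub, norm_smul, mul_pow, Real.norm_of_nonneg (inv_nonneg.2 hs.le), inv_pow,
      hsr]
  simp only [hd, ← Finset.mul_sum] at h
  calc _ ≤ r * (r⁻¹ * ∑ i, Metric.infDist (e i) (W : Set E) ^ 2) := by
        gcongr; linarith
    _ = _ := mul_inv_cancel_left₀ hr.ne' _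

end Hilbert

/-! ### Geometry of the curve of indicator functions -/

theorem integral_Omega_density_mul (y z : Unit01) :
    ∫ x : Omega, density y x * density z x = 1 - |(y : ℝ) - z| := by
  have h1 : (fun x : Omega => density y x * density z x) = fun x : Omega =>
      (Set.Icc (max ((y : ℝ) - 1) (z - 1)) (min (y : ℝ) z)).indicator (fun _ => (1 : ℝ)) (x : ℝ) := by
    funext x
    have h := Set.inter_indicator_mul (s := Set.Icc ((y : ℝ) - 1) y)
      (t := Set.Icc ((z : ℝ) - 1) z) (fun _ => (1 : ℝ)) (fun _ => (1 : ℝ)) (x : ℝ)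
    rw [mul_one, Set.Icc_inter_Icc] at h
    exact h.symm
  have hy := y.2
  have hz := z.2
  rw [h1]
  have h2 := integral_subtype_comap (μ := (volume : Measure ℝ)) (s := Set.Icc (-1 : ℝ) 1)
    measurableSet_Icc ((Set.Icc (max ((y : ℝ) - 1) (z - 1)) (min (y : ℝ) z)).indicator
      (fun _ => (1 : ℝ)))
  rw [← Measure.Subtype.volume_def] at h2
  refine h2.trans ?_
  rw [setIntegral_indicator measurableSet_Icc, Set.inter_eq_right.mpr
    (Set.Icc_subset_Icc (le_max_of_le_left (by linarith [hy.1])) (min_le_of_left_le hy.2))]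
  simp only [integral_const, smul_eq_mul, mul_one,
    Measure.real, Measure.restrict_apply_univ, Real.volume_Icc]
  rcases le_total (y : ℝ) z with h | h
  · rw [min_eq_left h, max_eq_right (by linarith), ENNReal.toReal_ofReal (by linarith [hz.2, hy.1]),
      abs_of_nonpos (by linarith)]
    ring
  · rw [min_eq_right h, max_eq_left (by linarith), ENNReal.toReal_ofReal (by linarith [hy.2, hz.1]),
      abs_of_nonneg (by linarith)]
    ring

theorem inner_solL2 (y z : Unit01) : inner ℝ (solL2 y) (solL2 z) = 1 - |(y : ℝ) - z| := by
  rw [L2.inner_def, ← integral_Omega_density_mul]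
  refine integral_congr_ae ?_
  filter_upwards [(density_memLp y).coeFn_toLp, (density_memLp z).coeFn_toLp] with x h1 h2
  simp only [solL2]
  rw [h1, h2]
  simp [mul_comm]

theorem norm_solL2_sub_sq (y z : Unit01) : ‖solL2 y - solL2 z‖ ^ 2 = 2 * |(y : ℝ) - z| := by
  rw [← real_inner_self_eq_norm_sq]
  simp only [inner_sub_left, inner_sub_right, inner_solL2, sub_self, abs_zero,
    abs_sub_comm (z : ℝ) y]
  ring

/-- The ordering fixes the sign inside every absolute value, so the four inner products are affine
in the endpoints and cancel. -/
theorem inner_solL2_increments_eq_zero {a b c d : Unit01} (hab : a ≤ b) (hbc : b ≤ c) (hcd : c ≤ d) :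
    inner ℝ (solL2 b - solL2 a) (solL2 d - solL2 c) = 0 := by
  have hab' : (a : ℝ) ≤ b := hab
  have hbc' : (b : ℝ) ≤ c := hbc
  have hcd' : (c : ℝ) ≤ d := hcd
  simp only [inner_sub_left, inner_sub_right, inner_solL2]
  rw [abs_of_nonpos (by linarith), abs_of_nonpos (by linarith), abs_of_nonpos (by linarith),
    abs_of_nonpos (by linarith)]
  ring

theorem continuous_solL2 : Continuous solL2 := by
  rw [Metric.continuous_iff]
  intro y ε hε
  refine ⟨ε ^ 2 / 2, by positivity, fun z hz => ?_⟩
  rw [dist_eq_norm]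
  refine lt_of_pow_lt_pow_left₀ 2 hε.le ?_
  rw [norm_solL2_sub_sq]
  rw [Subtype.dist_eq, Real.dist_eq] at hz
  linarith

/-! ### Lower bound for the average width -/

theorem quarter_le_sum_infDist_sq (n : ℕ) (W : Submodule ℝ L2Omega) [FiniteDimensional ℝ W]
    (hW : Module.finrank ℝ W = n) {t : ℝ} (ht : 0 ≤ t) (ht' : t ≤ 1 / (2 * n + 2 : ℝ)) :
    (1 / 4 : ℝ) ≤ ∑ k ∈ Finset.range (2 * n + 2),
      Metric.infDist (solL2 (Set.projIcc 0 1 zero_le_one ((k : ℝ) / (2 * n + 2) + t)))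
        (W : Set L2Omega) ^ 2 := by
  set N : ℝ := 2 * n + 2 with hN
  have hN0 : 0 < N := by positivity
  let y : ℕ → Unit01 := fun k => Set.projIcc 0 1 zero_le_one ((k : ℝ) / N + t)
  have hymono : Monotone y := fun i j hij => Set.monotone_projIcc _ (by gcongr)
  -- The bound on `t` keeps the shifted grid inside the unit interval, so the clamping by `projIcc`
  -- has no effect.
  have hyval : ∀ k : ℕ, k ≤ 2 * n + 1 → (y k : ℝ) = (k : ℝ) / N + t := by
    intro k hk
    have hk' : (k : ℝ) ≤ 2 * n + 1 := by exact_mod_cast hk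
    have h1 : (k : ℝ) / N + t ≤ 1 := by
      calc (k : ℝ) / N + t ≤ (2 * n + 1) / N + 1 / N := by gcongr
        _ = 1 := by rw [← add_div, div_eq_one_iff_eq hN0.ne', hN]; ring
    have h0 : 0 ≤ (k : ℝ) / N + t := by positivity
    exact congrArg Subtype.val (Set.projIcc_of_mem zero_le_one ⟨h0, h1⟩)
  let d : ℕ → ℝ := fun k => Metric.infDist (solL2 (y k)) (W : Set L2Omega) ^ 2
  have hd : ∀ k, 0 ≤ d k := fun k => sq_nonneg _
  have hnorm : ∀ i : Fin (2 * n + 1), ‖solL2 (y (i + 1)) - solL2 (y i)‖ ^ 2 = 2 / N := by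
    intro i
    rw [norm_solL2_sub_sq, hyval _ (by omega), hyval _ (by omega)]
    have h : ((i + 1 : ℕ) : ℝ) / N + t - ((i : ℕ) / N + t) = 1 / N := by
      push_cast; ring
    rw [h, abs_of_pos (by positivity)]
    ring
  have horth : Pairwise fun i j : Fin (2 * n + 1) =>
      inner ℝ (solL2 (y (i + 1)) - solL2 (y i)) (solL2 (y (j + 1)) - solL2 (y j)) = 0 := by
    have key : ∀ i j : Fin (2 * n + 1), i < j →
        inner ℝ (solL2 (y (i + 1)) - solL2 (y i)) (solL2 (y (j + 1)) - solL2 (y j)) = 0 :=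
      fun i j hij => inner_solL2_increments_eq_zero (hymono (Nat.le_succ _)) (hymono hij)
        (hymono (Nat.le_succ _))
    intro i j hij
    rcases lt_or_gt_of_ne hij with h | h
    · exact key i j h
    · rw [real_inner_comm]; exact key j i h
  have h := mul_card_sub_finrank_le_sum_infDist_sq (by positivity) hnorm horth W
  -- Each grid point is an endpoint of at most two increments, and splitting an increment costs a
  -- factor `2`; together this gives `4`.
  have hle : ∑ i : Fin (2 * n + 1),
      Metric.infDist (solL2 (y (i + 1)) - solL2 (y i)) (W : Set L2Omega) ^ 2 ≤
      4 * ∑ k ∈ Finset.range (2 * n + 2), d k := by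
    calc _ ≤ ∑ i : Fin (2 * n + 1), 2 * (d (i + 1) + d i) :=
          Finset.sum_le_sum fun i _ => infDist_submodule_sub_sq_le W _ _
      _ = 2 * (∑ k ∈ Finset.range (2 * n + 1), d (k + 1) +
            ∑ k ∈ Finset.range (2 * n + 1), d k) := by
          rw [Fin.sum_univ_eq_sum_range (fun k => 2 * (d (k + 1) + d k)), ← Finset.mul_sum,
            Finset.sum_add_distrib]
      _ ≤ _ := by
          have h1 := Finset.sum_range_succ d (2 * n + 1)
          have h2 := Finset.sum_range_succ' d (2 * n + 1)
          have h3 := hd (2 * n + 1)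
          have h4 := hd 0
          linarith
  -- At least `n + 1` of the `2n + 1` directions are missed, and `(n + 1) * 2 / N = 1` is what the
  -- choice of `N` achieves.
  have hval : 2 / N * ((Fintype.card (Fin (2 * n + 1)) : ℝ) - Module.finrank ℝ W) = 1 := by
    rw [hW, Fintype.card_fin, div_mul_eq_mul_div, div_eq_one_iff_eq hN0.ne', hN]
    push_cast; ring
  rw [hval] at h
  change (1 / 4 : ℝ) ≤ ∑ k ∈ Finset.range (2 * n + 2), d k
  linarith

/-- Cutting the unit interval into `N` cells and translating each to `[0, 1 / N]` turns the integral
into one of grid sums over the shift `t`, each at least `1 / 4`. -/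
theorem inv_le_integral_infDist_sq (n : ℕ) (W : Submodule ℝ L2Omega) [FiniteDimensional ℝ W]
    (hW : Module.finrank ℝ W = n) :
    1 / (4 * (2 * n + 2) : ℝ) ≤ ∫ y : Unit01, Metric.infDist (solL2 y) (W : Set L2Omega) ^ 2 := by
  let F : ℝ → ℝ := fun s =>
    Metric.infDist (solL2 (Set.projIcc 0 1 zero_le_one s)) (W : Set L2Omega) ^ 2
  have hF : Continuous F := ((Metric.continuous_infDist_pt _).comp
    (continuous_solL2.comp continuous_projIcc)).pow 2
  have h1 : ∫ y : Unit01, Metric.infDist (solL2 y) (W : Set L2Omega) ^ 2 =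
      ∫ s in (0 : ℝ)..1, F s := by
    rw [intervalIntegral.integral_of_le zero_le_one, ← integral_Icc_eq_integral_Ioc,
      ← integral_subtype_comap measurableSet_Icc, ← Measure.Subtype.volume_def]
    simp [F, Set.projIcc_val]
  set N : ℝ := 2 * n + 2 with hN
  have hN0 : 0 < N := by positivity
  have h2 : ∑ k ∈ Finset.range (2 * n + 2), ∫ s in ((k : ℝ) / N)..((k + 1 : ℕ) : ℝ) / N, F s =
      ∫ s in (0 : ℝ)..1, F s := by
    rw [intervalIntegral.sum_integral_adjacent_intervals (a := fun k : ℕ => (k : ℝ) / N)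
      fun k _ => hF.intervalIntegrable _ _]
    congr 1
    · simp
    · rw [div_eq_one_iff_eq hN0.ne', hN]; push_cast; ring
  have h3 : ∀ k : ℕ, ∫ s in ((k : ℝ) / N)..((k + 1 : ℕ) : ℝ) / N, F s =
      ∫ t in (0 : ℝ)..1 / N, F (k / N + t) := by
    intro k
    rw [intervalIntegral.integral_comp_add_left]
    congr 1
    · simp
    · push_cast; ring
  rw [h1, ← h2]
  simp only [h3]
  have hFk : ∀ k : ℕ, Continuous fun t => F (k / N + t) := fun k =>
    hF.comp (continuous_const.add continuous_id)
  rw [← intervalIntegral.integral_finsetSum fun k _ => (hFk k).intervalIntegrable _ _]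
  calc 1 / (4 * N) = ∫ t in (0 : ℝ)..1 / N, (1 / 4 : ℝ) := by
        rw [intervalIntegral.integral_const, smul_eq_mul]; field_simp; ring
    _ ≤ _ := by
        refine intervalIntegral.integral_mono_on (by positivity)
          (continuous_const.intervalIntegrable _ _)
          ((continuous_finsetSum _ fun k _ => hFk k).intervalIntegrable _ _) ?_
        intro t ht
        exact quarter_le_sum_infDist_sq n W hW ht.1 ht.2

theorem averageKolmogorovWidth_le_kolmogorovWidth {Z V : Type*} [MeasurableSpace Z]
    [NormedAddCommGroup V] [NormedSpace ℝ V] (μ : Measure Z) [IsProbabilityMeasure μ]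
    (u : Z → V) (n : ℕ) : averageKolmogorovWidth μ u n ≤ kolmogorovWidth u n := by
  refine iInf₂_mono fun W _ => ?_
  calc averageError μ u W ≤ (∫⁻ _, worstError u W ^ 2 ∂μ) ^ (1 / 2 : ℝ) := by
        refine ENNReal.rpow_le_rpow (lintegral_mono fun z => ?_) (by norm_num)
        exact pow_le_pow_left' (le_iSup (fun z => Metric.infEDist (u z) (W : Set V)) z) 2
    _ = worstError u W := by
        rw [lintegral_const, measure_univ, mul_one, ← ENNReal.rpow_natCast, ← ENNReal.rpow_mul]
        norm_num

theorem le_averageKolmogorovWidth_solL2 {n : ℕ} (hn : 1 ≤ n) :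
    ENNReal.ofReal (1 / 4 * (n : ℝ) ^ (-(1 / 2) : ℝ)) ≤
      averageKolmogorovWidth (volume : Measure Unit01) solL2 n := by
  refine le_iInf₂ fun W hW => ?_
  obtain ⟨hfin, hrank⟩ := hW
  have hn' : (1 : ℝ) ≤ n := by exact_mod_cast hn
  have hcont : Continuous fun y : Unit01 => Metric.infDist (solL2 y) (W : Set L2Omega) ^ 2 :=
    ((Metric.continuous_infDist_pt _).comp continuous_solL2).pow 2
  have hint : Integrable (fun y : Unit01 => Metric.infDist (solL2 y) (W : Set L2Omega) ^ 2) :=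
    hcont.integrable_of_hasCompactSupport (HasCompactSupport.of_compactSpace _)
  have h1 : ∫⁻ y : Unit01, Metric.infEDist (solL2 y) (W : Set L2Omega) ^ 2 =
      ENNReal.ofReal (∫ y : Unit01, Metric.infDist (solL2 y) (W : Set L2Omega) ^ 2) := by
    rw [ofReal_integral_eq_lintegral_ofReal hint (Filter.Eventually.of_forall fun _ => sq_nonneg _)]
    refine lintegral_congr fun y => ?_
    rw [ENNReal.ofReal_pow Metric.infDist_nonneg, Metric.infDist,
      ENNReal.ofReal_toReal (Metric.infEDist_ne_top W.nonempty)]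
  rw [averageError, h1, ENNReal.ofReal_rpow_of_nonneg
    (integral_nonneg fun _ => sq_nonneg _) (by norm_num)]
  refine ENNReal.ofReal_le_ofReal ?_
  calc 1 / 4 * (n : ℝ) ^ (-(1 / 2) : ℝ) = (1 / 16 * (n : ℝ)⁻¹) ^ (1 / 2 : ℝ) := by
        rw [Real.mul_rpow (by norm_num) (by positivity), Real.rpow_neg (by positivity),
          Real.inv_rpow (by positivity)]
        congr 1
        rw [← Real.sqrt_eq_rpow, show (1 / 16 : ℝ) = (1 / 4) ^ 2 by norm_num,
          Real.sqrt_sq (by norm_num)]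
    _ ≤ _ := by
        refine Real.rpow_le_rpow (by positivity) (le_trans ?_
          (inv_le_integral_infDist_sq n W hrank)) (by norm_num)
        -- Since `n ≥ 1`, one has `4 * (2n + 2) ≤ 16n`.
        rw [← one_div, div_mul_div_comm, one_mul]
        exact one_div_le_one_div_of_le (by positivity) (by linarith)

/-! ### Inverse distribution functions and the logarithmic map -/

theorem cdf_sol (y : Unit01) (x : Omega) : cdf (sol y) x = max (min (x : ℝ) y - (y - 1)) 0 := by
  have hms : MeasurableSet ((↑) ⁻¹' Set.Icc ((y : ℝ) - 1) (y : ℝ) : Set Omega) :=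
    measurable_subtype_coe measurableSet_Icc
  have h1 : (fun x : Omega => ENNReal.ofReal (density y x)) =
      ((↑) ⁻¹' Set.Icc ((y : ℝ) - 1) (y : ℝ) : Set Omega).indicator 1 := by
    funext x
    by_cases hx : (x : ℝ) ∈ Set.Icc ((y : ℝ) - 1) (y : ℝ)
    · rw [Set.indicator_of_mem (by exact hx)]
      simp [density, Set.indicator_of_mem hx]
    · rw [Set.indicator_of_notMem (by exact hx)]
      simp [density, Set.indicator_of_notMem hx]
  have h2 : ((sol y : ProbabilityMeasure Omega) : Measure Omega) (Set.Iic x) =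
      ENNReal.ofReal (min (x : ℝ) y - (y - 1)) := by
    change solMeasure y (Set.Iic x) = _
    rw [solMeasure, withDensity_apply _ measurableSet_Iic, h1, lintegral_indicator_one hms,
      Measure.restrict_apply hms, Measure.Subtype.volume_def,
      comap_subtype_coe_apply measurableSet_Icc, ← Real.volume_Icc]
    congr 1
    ext z
    have hy := y.2
    have hx := x.2
    simp only [Set.mem_image, Set.mem_inter_iff, Set.mem_preimage, Set.mem_Iic, Set.mem_Icc,
      le_min_iff]
    constructor
    · rintro ⟨w, ⟨⟨hw1, hw2⟩, hw3⟩, rfl⟩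
      exact ⟨hw1, hw3, hw2⟩
    · rintro ⟨hz1, hz2, hz3⟩
      exact ⟨⟨z, by linarith [hy.1], by linarith [hy.2]⟩, ⟨⟨hz1, hz3⟩, hz2⟩, rfl⟩
  rw [cdf, Measure.real, h2, ENNReal.toReal_ofReal']

/-- The value `s = 1` is excluded because no `x` has distribution function above `1`: there the
infimum is the default `1`, not `y`. -/
theorem icdf_sol (y s : Unit01) (hs : (s : ℝ) < 1) : (icdf (sol y) s : ℝ) = y - 1 + s := by
  have hy := y.2
  have hs0 := s.2.1
  have hmem : (y : ℝ) - 1 + s ∈ Set.Icc (-1 : ℝ) 1 :=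
    ⟨by linarith [hy.1], by linarith [hy.2]⟩
  have hset : {x : Omega | (s : ℝ) < cdf (sol y) x} = Set.Ioi ⟨(y : ℝ) - 1 + s, hmem⟩ := by
    ext x
    rw [Set.mem_ofPred_eq, cdf_sol, lt_max_iff, lt_sub_iff_add_lt, lt_min_iff, Set.mem_Ioi,
      ← Subtype.coe_lt_coe]
    constructor
    · rintro (h | h)
      · linarith [h.1]
      · exact absurd h hs0.not_gt
    · exact fun h => Or.inl ⟨by linarith, by linarith⟩
  have hlt : (y : ℝ) - 1 + s < 1 := by linarith [hy.2]
  have hg : IsGLB (Set.Ioi (⟨(y : ℝ) - 1 + s, hmem⟩ : Omega)) ⟨(y : ℝ) - 1 + s, hmem⟩ := by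
    refine ⟨fun x hx => le_of_lt hx, fun b hb => ?_⟩
    by_contra hcon
    have hcon' : (y : ℝ) - 1 + s < b := not_le.1 hcon
    have hb1 := b.2.2
    -- The midpoint of `y - 1 + s` and a supposedly larger lower bound `b` lies in the open ray but
    -- below `b`.
    have := hb (show (⟨((y : ℝ) - 1 + s + b) / 2, by linarith [hmem.1], by linarith⟩ : Omega) ∈ _
      from (by linarith : (y : ℝ) - 1 + s < ((y : ℝ) - 1 + s + b) / 2))
    have this' : (b : ℝ) ≤ ((y : ℝ) - 1 + s + b) / 2 := this
    linarith
  rw [icdf, hset, hg.sInf_eq]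

theorem logMap_sol (y₀ y : Unit01) : logMap (sol y₀) (sol y) =
    ((y : ℝ) - y₀) • (Lp.const 2 (volume : Measure Unit01) (1 : ℝ) : L2Unit) := by
  refine Lp.ext ?_
  -- The exceptional endpoint is a null set.
  have hne : ∀ᵐ s : Unit01, s ≠ 1 := by
    simp [ae_iff]
  filter_upwards [hne, Lp.coeFn_sub (icdfL2 (sol y)) (icdfL2 (sol y₀)),
    (icdf_memLp (sol y)).coeFn_toLp, (icdf_memLp (sol y₀)).coeFn_toLp,
    Lp.coeFn_smul ((y : ℝ) - y₀) (Lp.const 2 (volume : Measure Unit01) (1 : ℝ) : L2Unit),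
    Lp.coeFn_const 2 (volume : Measure Unit01) (1 : ℝ)] with s hs h1 h2 h3 h4 h5
  have hs1 : (s : ℝ) < 1 := lt_of_le_of_ne s.2.2 fun h => hs (Subtype.ext h)
  rw [logMap, h1, h4, Pi.sub_apply, Pi.smul_apply, h5]
  simp only [icdfL2]
  rw [h2, h3, icdf_sol y s hs1, icdf_sol y₀ s hs1]
  simp

/-! ### Subspaces of prescribed dimension containing the constants -/

open Polynomial in
theorem toLp_polynomial_injective : Function.Injective
    ((ContinuousMap.toLp (E := ℝ) 2 (volume : Measure Unit01) ℝ).toLinearMap ∘ₗ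
      (toContinuousMapOnAlgHom (R := ℝ) (Set.Icc (0 : ℝ) 1)).toLinearMap) := by
  rw [injective_iff_map_eq_zero]
  intro p hp
  by_contra hne
  have hae : ∀ᵐ s : Unit01, p.eval (s : ℝ) = 0 := by
    filter_upwards [ContinuousMap.coeFn_toLp (p := 2) (𝕜 := ℝ) (volume : Measure Unit01)
      (toContinuousMapOnAlgHom (R := ℝ) (Set.Icc (0 : ℝ) 1) p),
      Lp.coeFn_zero ℝ 2 (volume : Measure Unit01)] with s h1 h2
    have h3 : (ContinuousMap.toLp (E := ℝ) 2 (volume : Measure Unit01) ℝ)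
      (toContinuousMapOnAlgHom (R := ℝ) (Set.Icc (0 : ℝ) 1) p) = 0 := hp
    rw [h3, h2] at h1
    exact h1.symm
  have hfin : {s : Unit01 | p.eval (s : ℝ) = 0}.Finite :=
    (p.finite_setOfPred_isRoot hne).preimage Subtype.val_injective.injOn
  have hnull : ∀ᵐ s : Unit01, ¬ p.eval (s : ℝ) = 0 := by
    rw [ae_iff]
    simpa using hfin.measure_zero volume
  obtain ⟨s, h1, h2⟩ := (hae.and hnull).exists
  exact h2 h1

open Polynomial in
-- The width ranges over subspaces of dimension exactly `n`, so the line of constants must be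
-- enlarged. Polynomials of degree below `n` serve: a nonzero polynomial has finitely many roots, so
-- passing to almost everywhere classes loses no dimension.
theorem exists_finrank_eq_const_mem {n : ℕ} (hn : 1 ≤ n) : ∃ W : Submodule ℝ L2Unit,
    (FiniteDimensional ℝ W ∧ Module.finrank ℝ W = n) ∧
      (Lp.const 2 (volume : Measure Unit01) (1 : ℝ) : L2Unit) ∈ W := by
  let L := (ContinuousMap.toLp (E := ℝ) 2 (volume : Measure Unit01) ℝ).toLinearMap ∘ₗ
      (toContinuousMapOnAlgHom (R := ℝ) (Set.Icc (0 : ℝ) 1)).toLinearMap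
  let e := (Submodule.equivMapOfInjective L toLp_polynomial_injective (degreeLT ℝ n)).symm.trans
    (degreeLTEquiv ℝ n)
  refine ⟨(degreeLT ℝ n).map L, ⟨e.symm.finiteDimensional, by simp [e.finrank_eq]⟩, 1, ?_, ?_⟩
  · rw [SetLike.mem_coe, mem_degreeLT]
    exact degree_one_le.trans_lt (by exact_mod_cast hn)
  · refine Lp.ext ?_
    filter_upwards [ContinuousMap.coeFn_toLp (p := 2) (𝕜 := ℝ) (volume : Measure Unit01)
      (toContinuousMapOnAlgHom (R := ℝ) (Set.Icc (0 : ℝ) 1) 1),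
      Lp.coeFn_const 2 (volume : Measure Unit01) (1 : ℝ)] with s h1 h2
    rw [h2]
    refine h1.trans ?_
    simp

end TransportWidth

theorem mainTheorem1 :
    (∃ c : ℝ, 0 < c ∧ ∀ n : ℕ, 1 ≤ n →
      averageKolmogorovWidth (volume : Measure Unit01) solL2 n ≤ kolmogorovWidth solL2 n ∧
      ENNReal.ofReal (c * (n : ℝ) ^ (-(1 / 2) : ℝ)) ≤
        averageKolmogorovWidth (volume : Measure Unit01) solL2 n) ∧
    (∀ y₀ : Unit01,
      (∀ y : Unit01, logMap (sol y₀) (sol y) ∈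
        Submodule.span ℝ {(Lp.const 2 (volume : Measure Unit01) (1 : ℝ) : L2Unit)}) ∧
      ∀ n : ℕ, 1 < n → kolmogorovWidth (fun y : Unit01 => logMap (sol y₀) (sol y)) n = 0) := by
  refine ⟨⟨1 / 4, by norm_num, fun n hn => ⟨averageKolmogorovWidth_le_kolmogorovWidth _ _ _,
    le_averageKolmogorovWidth_solL2 hn⟩⟩, fun y₀ => ⟨fun y => ?_, fun n hn => ?_⟩⟩
  · rw [logMap_sol]
    exact Submodule.smul_mem _ _ (Submodule.mem_span_singleton_self _)
  · obtain ⟨W, hW, hmem⟩ := exists_finrank_eq_const_mem hn.le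
    refine le_antisymm (iInf₂_le_of_le W hW (iSup_le fun y => ?_)) bot_le
    simp only [logMap_sol]
    exact (Metric.infEDist_zero_of_mem (W.smul_mem _ hmem)).le
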